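/- Let $n,N$ be integers with $1\le N\le n$, let $\alpha\in[0,1]$, $\gamma>0$ and $c'\in\mathbb{R}^n$, and for each page $i\in[n]=\{1,\dots,n\}$ let $\mathcal{F}_i\subseteq[n]$ be the set of pages that $i$ points to, with $D_i=|\mathcal{F}_i|$ (possibly $0$). **The MaxRank problem.** In page $i$ an action is a pair $(I,J)$ with $I\subseteq[n]$, $|I|=N$ and $J\subseteq\mathcal{F}_i$. Let $z_y(I)=1/|I|$ if $y\in I$ and $0$ otherwise; let $\nu(I,J)=z(I)$ if $J=\emptyset$, and otherwise $\nu_y(I,J)=1/|J|$ if $y\in J$ and $0$ if not. The transition probabilities are $p(y\mid i,I,J)=\alpha\nu_y(I,J)+(1-\alpha)z_y(I)$ and the cost is $c(i,I,J)=c'_i+\gamma\frac{D_i-|J|}{D_i}$ (here and below the penalty term is $0$ if $D_i=0$). The MaxRank ergodic control problem is to minimize $$\limsup_{T\to\infty}\frac1T\,\mathbb{E}\Big(\sum_{t=0}^{T-1}c(X_t,I_t,J_t)\Big)$$ over all (history-dependent, randomized) strategies, for a given law of $X_0$; its value is the infimum. **The polytopes.** Let $Z=\{z\in\mathbb{R}^n:\sum_i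 z_i=1,\ 0\le z_i\le 1/N\}$. Let $\mathcal{P}_i$ be the set of $(\sigma,\nu)\in\mathbb{R}^{D_i+1}\times\mathbb{R}^n$ for which there is $w\in\mathbb{R}^{(D_i+1)\times n}$ such that $\sum_{d=0}^{D_i}\sigma^d=1$; $\sigma^d\ge0$ for all $d$; $\nu_j=\sum_{d=0}^{D_i}w^d_j$ for all $j$; $\sum_j w^d_j=\sigma^d$ for all $d$; $0\le w^0_j\le\sigma^0/N$ for all $j$; and, for $1\le d\le D_i$, $w^d_j=0$ if $j\notin\mathcal{F}_i$ and $0\le w^d_j\le\sigma^d/d$ if $j\in\mathcal{F}_i$. **Claim.** The dynamic programming equation $$v_i+\lambda=\min_{(\sigma,\nu)\in\mathcal{P}_i,\ z\in Z}\Big\{c'_i+\gamma\,\frac{D_i-\sum_{d=0}^{D_i}d\,\sigma^d}{D_i}+\sum_{j\in[n]}(\alpha\nu_j+(1-\alpha)z_j)v_j\Big\},\qquad i\in[n],\qquad(*)$$ has a solution $v\in\mathbb{R}^n$, $\lambda\in\mathbb{R}$, and the constant $\lambda$ is the same for all solutions. For every solution $(v,\lambda)$: 1. For every law of $X_0$,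 $\lambda$ is the value of the MaxRank problem. It is also the value of the relaxed problem, in which the actions in page $i$ are all $((\sigma,\nu),z)\in\mathcal{P}_i\times Z$, with cost $c'_i+\gamma\frac{D_i-\sum_d d\sigma^d}{D_i}$ and transition probabilities $\alpha\nu_y+(1-\alpha)z_y$ (strategies being history-dependent, with discrete randomization). 2. For every selection, in each page $i$, of $(\sigma_i,\nu_i)\in\mathcal{P}_i$ and $z_i\in Z$ attaining the minimum in $(*)$, the stationary strategy that uses these actions is optimal in the relaxed problem for every law of $X_0$. Moreover, there is a randomized stationary strategy of the MaxRank problem that has in every page the same transition probabilities and the same expected cost, and every such strategy is optimal in the MaxRank problem for every law of $X_0$. 3. There is a choice of MaxRank actions $(I_i,J_i)_{i\in[n]}$ such that in each page $i$ the minimum in $(*)$ is attained at $(\sigma(J_i),\nu(I_i,J_i))\in\mathcal{P}_i$ and $z(I_i)\in Z$, where $\sigma^d(J)=1$ if $d=|J|$ and $0$ otherwise. For every such choice, the deterministic stationary strategy $i\mapsto(I_i,J_i)$ is optimal in the MaxRank problem for every law of $X_0$. -/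

import Mathlib

open scoped BigOperators

noncomputable section

/-! ### Controlled Markov chains with long-run average cost -/

/-- A Markov decision process with state space `S`: for each state `i`, a type of admissible
actions, a transition law `trans i a` (a probability on `S`) and an instantaneous cost. -/
structure MarkovDecision (S : Type) where
  Action : S → Type
  trans : (i : S) → Action i → PMF S
  cost : (i : S) → Action i → ℝ

namespace MarkovDecision

variable {S : Type} (M : MarkovDecision S)

/-- The past `(X₀, a₀), …, (X_{t-1}, a_{t-1})` of the process, in chronological order. -/
abbrev Past : Type := List (Σ i : S, M.Action i)

/-- A randomized, history-dependent control strategy: given the past and the current state,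
a probability on the actions that are admissible in the current state. The time `t` is the
length of the past. -/
abbrev Strategy : Type := M.Past → (x : S) → PMF (M.Action x)

/-- The randomized stationary (feedback) strategy given by a map on states. -/
def randomizedStationary (f : (i : S) → PMF (M.Action i)) : M.Strategy := fun _ x => f x

/-- The deterministic stationary (feedback) strategy given by a map on states. -/
def stationary (f : (i : S) → M.Action i) : M.Strategy := fun _ x => PMF.pure (f x)

/-- The joint law of `((X₀, a₀), …, (X_{t-1}, a_{t-1}))` and `X_t` under the strategy `π`, when
`X₀` has law `μ`. -/
def historyLaw (μ : PMF S) (π : M.Strategy) : ℕ → PMF (M.Past × S)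
  | 0 => μ.map fun x => ([], x)
  | t + 1 => (historyLaw μ π t).bind fun h =>
      (π h.1 h.2).bind fun a =>
        (M.trans h.2 a).map fun y => (h.1 ++ [⟨h.2, a⟩], y)

/-- The expectation of `∑_{t < T} c(X_t, a_t)`. -/
def expectedCost (μ : PMF S) (π : M.Strategy) (T : ℕ) : ℝ :=
  ∑' h : M.Past × S,
    (M.historyLaw μ π T h).toReal * (h.1.map fun xa => M.cost xa.1 xa.2).sum

/-- The long-run average cost `limsup_T (1/T) E(∑_{t < T} c(X_t, a_t))`. -/
def averageCost (μ : PMF S) (π : M.Strategy) : ℝ :=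
  Filter.limsup (fun T : ℕ => 1 / (T : ℝ) * M.expectedCost μ π T) Filter.atTop

/-- `r` is the value of the ergodic control problem (infimum of the average cost over all
strategies), for every initial law. -/
def IsValue (r : ℝ) : Prop :=
  ∀ μ : PMF S, IsGLB (Set.range (M.averageCost μ)) r

/-- The strategy `π` minimizes the average cost, for every initial law. -/
def IsOptimal (π : M.Strategy) : Prop :=
  ∀ (μ : PMF S) (π' : M.Strategy), M.averageCost μ π ≤ M.averageCost μ π'

end MarkovDecision

/-! ### The web graph model -/

/-- The data of the MaxRank problem on `n` pages. -/
structure WebModel (n : ℕ) where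
  /-- the set of pages pointed to by a page in the web graph -/
  F : Fin n → Finset (Fin n)
  /-- the a priori cost of a page -/
  c' : Fin n → ℝ
  /-- the penalty factor -/
  γ : ℝ
  γ_pos : 0 < γ
  /-- the damping factor -/
  α : ℝ
  α_nonneg : 0 ≤ α
  α_le_one : α ≤ 1
  /-- the number of pages to which teleportation is permitted -/
  N : ℕ
  N_pos : 1 ≤ N
  N_le : N ≤ n

/-- The probability on the pages with weights `α ν_j + (1 - α) z_j`. -/
def mixPMF {n : ℕ} (α : ℝ) (ν z : Fin n → ℝ) (h0 : ∀ j, 0 ≤ α * ν j + (1 - α) * z j)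
    (h1 : ∑ j, (α * ν j + (1 - α) * z j) = 1) : PMF (Fin n) :=
  PMF.ofFintype (fun j => ENNReal.ofReal (α * ν j + (1 - α) * z j)) (by
    rw [← ENNReal.ofReal_sum_of_nonneg fun j _ => h0 j, h1, ENNReal.ofReal_one])

namespace WebModel

variable {n : ℕ} (M : WebModel n)

/-- The number of hyperlinks of page `x`. -/
def D (x : Fin n) : ℕ := (M.F x).card

/-- The teleportation vector `z(I)`. -/
def zOf (I : Finset (Fin n)) (y : Fin n) : ℝ :=
  if y ∈ I then (I.card : ℝ)⁻¹ else 0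

/-- The hyperlink click probabilities `ν(I, J)`. -/
def nuOf (I J : Finset (Fin n)) (y : Fin n) : ℝ :=
  if J = ∅ then zOf I y else if y ∈ J then (J.card : ℝ)⁻¹ else 0

/-- The vector `σ(J)`, with entry `1` at `d = |J|` and `0` elsewhere. -/
def sigmaOf (x : Fin n) (J : Finset (Fin n)) (d : Fin (M.D x + 1)) : ℝ :=
  if (d : ℕ) = J.card then 1 else 0

/-- The pairs `(I, J)` that are admissible in page `x`. -/
def Admissible (x : Fin n) (I J : Finset (Fin n)) : Prop := I.card = M.N ∧ J ⊆ M.F x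

/-- The cost `c(x, I, J) = c'_x + γ (D_x - |J|) / D_x`; without hyperlinks (`D_x = 0`) there is
nothing to remove and the penalty is `0`. -/
def linkCost (x : Fin n) (J : Finset (Fin n)) : ℝ :=
  M.c' x + M.γ * (((M.D x : ℝ) - (J.card : ℝ)) / (M.D x : ℝ))

/-- The polytope `Z`. -/
def Z : Set (Fin n → ℝ) :=
  {z | ∑ i, z i = 1 ∧ ∀ i, 0 ≤ z i ∧ z i ≤ 1 / (M.N : ℝ)}

/-- The polytope `P_x` of pairs `(σ, ν)`. -/
def P (x : Fin n) : Set ((Fin (M.D x + 1) → ℝ) × (Fin n → ℝ)) :=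
  {p | ∃ w : Fin (M.D x + 1) → Fin n → ℝ,
    (∑ d, p.1 d = 1) ∧
    (∀ d, 0 ≤ p.1 d) ∧
    (∀ j, p.2 j = ∑ d, w d j) ∧
    (∀ d, ∑ j, w d j = p.1 d) ∧
    (∀ j, 0 ≤ w 0 j ∧ w 0 j ≤ p.1 0 / (M.N : ℝ)) ∧
    (∀ j, j ∉ M.F x → ∀ d, d ≠ 0 → w d j = 0) ∧
    (∀ j, j ∈ M.F x → ∀ d, d ≠ 0 → 0 ≤ w d j ∧ w d j ≤ p.1 d / ((d : ℕ) : ℝ))}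

/-- The cost `c'_x + γ (D_x - ∑_d d σ^d) / D_x`; the penalty is `0` if `D_x = 0`. -/
def relaxedCost (x : Fin n) (σ : Fin (M.D x + 1) → ℝ) : ℝ :=
  M.c' x + M.γ * (((M.D x : ℝ) - ∑ d : Fin (M.D x + 1), ((d : ℕ) : ℝ) * σ d) / (M.D x : ℝ))

/-- The expression minimized in the dynamic programming equation. -/
def bellman (v : Fin n → ℝ) (x : Fin n) (σ : Fin (M.D x + 1) → ℝ) (ν z : Fin n → ℝ) : ℝ :=
  M.relaxedCost x σ + ∑ j, (M.α * ν j + (1 - M.α) * z j) * v j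

/-- `(v, lam)` solves the ergodic dynamic programming equation: for each page `i`, `v_i + lam`
is the (attained) minimum over `P_i × Z`. -/
def IsSolution (v : Fin n → ℝ) (lam : ℝ) : Prop :=
  ∀ i, IsLeast {r | ∃ σ ν z, (σ, ν) ∈ M.P i ∧ z ∈ M.Z ∧ r = M.bellman v i σ ν z} (v i + lam)

/-! Auxiliary facts: the transition weights are probabilities. -/

theorem zOf_nonneg (I : Finset (Fin n)) (y : Fin n) : 0 ≤ zOf I y := by
  unfold zOf; split_ifs <;> positivity

theorem nuOf_nonneg (I J : Finset (Fin n)) (y : Fin n) : 0 ≤ nuOf I J y := by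
  unfold nuOf
  split_ifs
  · exact zOf_nonneg I y
  · positivity
  · exact le_rfl

theorem sum_inv_card (I : Finset (Fin n)) (h : I.card ≠ 0) :
    ∑ y, (if y ∈ I then (I.card : ℝ)⁻¹ else 0) = 1 := by
  rw [Finset.sum_ite_mem, Finset.univ_inter, Finset.sum_const, nsmul_eq_mul]
  exact mul_inv_cancel₀ (by exact_mod_cast h)

theorem sum_zOf (I : Finset (Fin n)) (h : I.card ≠ 0) : ∑ y, zOf I y = 1 := by
  unfold zOf; exact sum_inv_card I h

theorem sum_nuOf (I J : Finset (Fin n)) (h : I.card ≠ 0) : ∑ y, nuOf I J y = 1 := by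
  unfold nuOf
  by_cases hJ : J = ∅
  · simp only [hJ, if_true]; exact sum_zOf I h
  · simp only [hJ, if_false]; exact sum_inv_card J (by simpa using hJ)

theorem nonneg_of_mem_P {x : Fin n} {p : (Fin (M.D x + 1) → ℝ) × (Fin n → ℝ)}
    (h : p ∈ M.P x) (j : Fin n) : 0 ≤ p.2 j := by
  obtain ⟨w, -, -, h3, -, h5, h6, h7⟩ := h
  rw [h3 j]
  refine Finset.sum_nonneg fun d _ => ?_
  by_cases hd : d = 0
  · rw [hd]; exact (h5 j).1
  · by_cases hj : j ∈ M.F x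
    · exact (h7 j hj d hd).1
    · exact (h6 j hj d hd).ge

theorem sum_of_mem_P {x : Fin n} {p : (Fin (M.D x + 1) → ℝ) × (Fin n → ℝ)}
    (h : p ∈ M.P x) : ∑ j, p.2 j = 1 := by
  obtain ⟨w, h1, -, h3, h4, -⟩ := h
  rw [Finset.sum_congr rfl fun j _ => h3 j, Finset.sum_comm,
    Finset.sum_congr rfl fun d _ => h4 d, h1]

theorem mix_nonneg {ν z : Fin n → ℝ} (hν : ∀ j, 0 ≤ ν j) (hz : ∀ j, 0 ≤ z j) (j : Fin n) :
    0 ≤ M.α * ν j + (1 - M.α) * z j :=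
  add_nonneg (mul_nonneg M.α_nonneg (hν j)) (mul_nonneg (sub_nonneg.2 M.α_le_one) (hz j))

theorem mix_sum {ν z : Fin n → ℝ} (hν : ∑ j, ν j = 1) (hz : ∑ j, z j = 1) :
    ∑ j, (M.α * ν j + (1 - M.α) * z j) = 1 := by
  rw [Finset.sum_add_distrib, ← Finset.mul_sum, ← Finset.mul_sum, hν, hz]; ring

theorem card_ne_zero {I : Finset (Fin n)} (h : I.card = M.N) : I.card ≠ 0 := by
  have := M.N_pos
  omega

/-! ### The control problems -/

/-- The MaxRank ergodic control problem: in page `x` one selects `I` with `|I| = N` and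
`J ⊆ F_x`. -/
def maxRank : MarkovDecision (Fin n) where
  Action x := {a : Finset (Fin n) × Finset (Fin n) // M.Admissible x a.1 a.2}
  trans _ a := mixPMF M.α (nuOf a.1.1 a.1.2) (zOf a.1.1)
    (M.mix_nonneg (nuOf_nonneg _ _) (zOf_nonneg _))
    (M.mix_sum (sum_nuOf _ _ (M.card_ne_zero a.2.1)) (sum_zOf _ (M.card_ne_zero a.2.1)))
  cost x a := M.linkCost x a.1.2

/-- The control problem in which the actions in page `x` are all `(σ, ν) ∈ P_x`, `z ∈ Z`. -/
def relaxed : MarkovDecision (Fin n) where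
  Action x := {a : ((Fin (M.D x + 1) → ℝ) × (Fin n → ℝ)) × (Fin n → ℝ) //
    a.1 ∈ M.P x ∧ a.2 ∈ M.Z}
  trans _ a := mixPMF M.α a.1.1.2 a.1.2
    (M.mix_nonneg (M.nonneg_of_mem_P a.2.1) fun j => (a.2.2.2 j).1)
    (M.mix_sum (M.sum_of_mem_P a.2.1) a.2.2.1)
  cost x a := M.relaxedCost x a.1.1.1

/-- The selection `((σ_i, ν_i), z_i)_i` attains the minima in the dynamic programming equation
with solution `(v, lam)`. -/
def Minimizing (v : Fin n → ℝ) (lam : ℝ) (a : ∀ i, M.relaxed.Action i) : Prop :=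
  ∀ i, M.bellman v i (a i).1.1.1 (a i).1.1.2 (a i).1.2 = v i + lam

/-- The selection `(I_i, J_i)_i` of MaxRank actions attains, through `σ(J)`, `ν(I, J)`, `z(I)`,
the minima in the dynamic programming equation with solution `(v, lam)`. -/
def MinimizingLinks (v : Fin n → ℝ) (lam : ℝ) (b : ∀ i, M.maxRank.Action i) : Prop :=
  ∀ i, (M.sigmaOf i (b i).1.2, nuOf (b i).1.1 (b i).1.2) ∈ M.P i ∧ zOf (b i).1.1 ∈ M.Z ∧
    M.bellman v i (M.sigmaOf i (b i).1.2) (nuOf (b i).1.1 (b i).1.2) (zOf (b i).1.1) = v i + lam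

/-- Randomized choices `f i` of `(I, J)` implement the actions `a i`: in every page they have
the same transition probabilities and the same expected cost. -/
def Implements (f : ∀ i, PMF (M.maxRank.Action i)) (a : ∀ i, M.relaxed.Action i) : Prop :=
  ∀ i, (f i).bind (M.maxRank.trans i) = M.relaxed.trans i (a i) ∧
    ∑' b, (f i b).toReal * M.maxRank.cost i b = M.relaxed.cost i (a i)

end WebModel

end

/-!
The long-run average cost of both control problems is governed by one inequality. If
`v x + lam ≤ c(x, a) + E_{x,a} v` for all actions, then along any strategy the expected cost of the
first `T` steps is at least `T * lam + E v(X_0) - E v(X_T)`, and a strategy that attains equality at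
each step has exactly this cost. As `v` is bounded, `lam` is the value and such a strategy is
optimal (`MarkovDecision.isValue_of_oneStep_eq`, `MarkovDecision.isOptimal_of_oneStep_eq`). This holds for
randomized actions and for any initial law, and makes the constant `lam` unique, since a problem has
only one value.

The equation has a solution because each page may remove all its hyperlinks and teleport to a set
containing any prescribed page, which is thus reached in one step with probability `1 / N`. This
bounds the span of the solutions of the discounted equations uniformly in the discount factor, and a
limit point of their normalizations solves the ergodic equation (`exists_additive_eigenvector`).

The two problems are equivalent because the transition probabilities and cost of a relaxed action
are a convex combination of those of the pairs `(I, J)`. By the Hahn–Banach theorem it suffices that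
no linear functional of (transition probabilities, cost) is smaller at the relaxed action than at
all pairs (`WebModel.exists_action_le`). For a given functional, the best `I` consists of the `N`
pages of smallest weight and the best `J` of size `d` of the `d` smallest in `F_x`, both by a greedy
exchange argument. The same statement for the functional given by `v` shows that the minimum in the
dynamic programming equation is attained at a pair `(I, J)`.
-/

/-! ### Expectations of bounded functions under discrete laws -/

namespace PMF

variable {β δ : Type}

/-- The expectation of `f` under the discrete law `p`, as a series; it is meaningful when `f` is
bounded on the support of `p`. -/
noncomputable def expect (p : PMF β) (f : β → ℝ) : ℝ := ∑' x, (p x).toReal * f x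

theorem summable_toReal (p : PMF β) : Summable fun x => (p x).toReal :=
  ENNReal.summable_toReal p.tsum_coe_ne_top

theorem tsum_toReal (p : PMF β) : ∑' x, (p x).toReal = 1 := by
  rw [← ENNReal.tsum_toReal_eq p.apply_ne_top, p.tsum_coe, ENNReal.toReal_one]

theorem summable_expect (p : PMF β) {f : β → ℝ} {C : ℝ} (hf : ∀ x ∈ p.support, |f x| ≤ C) :
    Summable fun x => (p x).toReal * f x := by
  refine Summable.of_norm_bounded (p.summable_toReal.mul_right C) fun x => ?_
  rw [norm_mul, Real.norm_of_nonneg ENNReal.toReal_nonneg, Real.norm_eq_abs]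
  by_cases hx : x ∈ p.support
  · exact mul_le_mul_of_nonneg_left (hf x hx) ENNReal.toReal_nonneg
  · rw [p.apply_eq_zero_iff x |>.2 hx]; simp

theorem expect_congr (p : PMF β) {f g : β → ℝ} (h : ∀ x ∈ p.support, f x = g x) :
    p.expect f = p.expect g := by
  refine tsum_congr fun x => ?_
  by_cases hx : x ∈ p.support
  · rw [h x hx]
  · rw [p.apply_eq_zero_iff x |>.2 hx]; simp

theorem expect_mono (p : PMF β) {f g : β → ℝ} {C C' : ℝ} (hf : ∀ x ∈ p.support, |f x| ≤ C)
    (hg : ∀ x ∈ p.support, |g x| ≤ C') (h : ∀ x ∈ p.support, f x ≤ g x) :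
    p.expect f ≤ p.expect g := by
  refine (p.summable_expect hf).tsum_le_tsum (fun x => ?_) (p.summable_expect hg)
  by_cases hx : x ∈ p.support
  · exact mul_le_mul_of_nonneg_left (h x hx) ENNReal.toReal_nonneg
  · rw [p.apply_eq_zero_iff x |>.2 hx]; simp

theorem expect_const (p : PMF β) (c : ℝ) : p.expect (fun _ => c) = c := by
  rw [expect, tsum_mul_right, tsum_toReal, one_mul]

theorem expect_add (p : PMF β) {f g : β → ℝ} {C C' : ℝ} (hf : ∀ x ∈ p.support, |f x| ≤ C)
    (hg : ∀ x ∈ p.support, |g x| ≤ C') :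
    p.expect (fun x => f x + g x) = p.expect f + p.expect g := by
  unfold expect
  rw [← (p.summable_expect hf).tsum_add (p.summable_expect hg)]
  exact tsum_congr fun x => mul_add _ _ _

theorem expect_const_add (p : PMF β) (c : ℝ) {f : β → ℝ} {C : ℝ}
    (hf : ∀ x ∈ p.support, |f x| ≤ C) : p.expect (fun x => c + f x) = c + p.expect f := by
  rw [p.expect_add (f := fun _ => c) (C := |c|) (fun _ _ => le_rfl) hf, expect_const]

theorem abs_expect_le (p : PMF β) {f : β → ℝ} {C : ℝ} (hf : ∀ x ∈ p.support, |f x| ≤ C) :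
    |p.expect f| ≤ C := by
  rw [abs_le]
  constructor
  · rw [← p.expect_const (-C)]
    exact p.expect_mono (C := |-C|) (fun _ _ => le_rfl) hf fun x hx => (abs_le.1 (hf x hx)).1
  · conv_rhs => rw [← p.expect_const C]
    exact p.expect_mono (C' := |C|) hf (fun _ _ => le_rfl) fun x hx => (abs_le.1 (hf x hx)).2

theorem expect_pure (b : β) (f : β → ℝ) : (PMF.pure b).expect f = f b := by
  unfold expect
  rw [tsum_eq_single b]
  · simp
  · intro x hx
    simp [PMF.pure_apply, hx]

/-- The tower rule: averaging first over the mixing law `p` and then over `q a`. -/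
theorem expect_bind (p : PMF β) (q : β → PMF δ) {f : δ → ℝ} {C : ℝ}
    (hf : ∀ x ∈ (p.bind q).support, |f x| ≤ C) :
    (p.bind q).expect f = p.expect fun a => (q a).expect f := by
  have hne : ∀ x a, p a * q a x ≠ ⊤ := fun x a =>
    ENNReal.mul_ne_top (p.apply_ne_top a) ((q a).apply_ne_top x)
  have hs : Summable (Function.uncurry fun x a => (p a * q a x).toReal * f x) := by
    have h1 : Summable fun z : δ × β => (p z.2 * q z.2 z.1).toReal := by
      refine ENNReal.summable_toReal ?_
      rw [ENNReal.tsum_prod', ENNReal.tsum_comm]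
      simp [ENNReal.tsum_mul_left, PMF.tsum_coe]
    refine Summable.of_norm_bounded (h1.mul_right C) fun z => ?_
    rw [Function.uncurry, norm_mul, Real.norm_of_nonneg ENNReal.toReal_nonneg, Real.norm_eq_abs]
    by_cases hx : p z.2 * q z.2 z.1 = 0
    · simp [hx]
    · refine mul_le_mul_of_nonneg_left (hf z.1 ?_) ENNReal.toReal_nonneg
      rw [PMF.mem_support_bind_iff]
      exact ⟨z.2, (PMF.mem_support_iff _ _).2 (left_ne_zero_of_mul hx),
        (PMF.mem_support_iff _ _).2 (right_ne_zero_of_mul hx)⟩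
  calc (p.bind q).expect f = ∑' x, ∑' a, (p a * q a x).toReal * f x := by
        refine tsum_congr fun x => ?_
        rw [PMF.bind_apply, ENNReal.tsum_toReal_eq (hne x), tsum_mul_right]
    _ = ∑' a, ∑' x, (p a * q a x).toReal * f x := hs.tsum_comm.symm
    _ = _ := by
        refine tsum_congr fun a => ?_
        change _ = (p a).toReal * ∑' x, (q a x).toReal * f x
        rw [← tsum_mul_left]
        exact tsum_congr fun x => by rw [ENNReal.toReal_mul, mul_assoc]

theorem expect_map (p : PMF β) (g : β → δ) {f : δ → ℝ} {C : ℝ}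
    (hf : ∀ x ∈ (p.map g).support, |f x| ≤ C) :
    (p.map g).expect f = p.expect fun a => f (g a) := by
  rw [PMF.map] at *
  rw [expect_bind _ _ hf]
  exact expect_congr _ fun a _ => expect_pure _ _

end PMF

/-! ### Verification of the ergodic dynamic programming equation -/

namespace MarkovDecision

variable {S : Type} (M : MarkovDecision S)

/-- The cost accumulated along a past. -/
noncomputable def pathCost (h : M.Past) : ℝ := (h.map fun xa => M.cost xa.1 xa.2).sum

theorem pathCost_append (h : M.Past) (x : S) (a : M.Action x) :
    M.pathCost (h ++ [⟨x, a⟩]) = M.pathCost h + M.cost x a := by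
  simp [pathCost]

theorem length_of_mem_support_historyLaw (μ : PMF S) (π : M.Strategy) (t : ℕ)
    {h : M.Past × S} (hh : h ∈ (M.historyLaw μ π t).support) : h.1.length = t := by
  induction t generalizing h with
  | zero =>
    simp only [historyLaw, PMF.mem_support_map_iff] at hh
    obtain ⟨x, -, rfl⟩ := hh
    rfl
  | succ t ih =>
    simp only [historyLaw, PMF.mem_support_bind_iff, PMF.mem_support_map_iff] at hh
    obtain ⟨h', hh', a, -, y, -, rfl⟩ := hh
    simp [ih hh']

variable {M} {C V : ℝ} {v : S → ℝ}

theorem abs_pathCost_le (hC : ∀ i a, |M.cost i a| ≤ C) (h : M.Past) :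
    |M.pathCost h| ≤ h.length * C := by
  induction h with
  | nil => simp [pathCost]
  | cons xa h ih =>
    have : M.pathCost (xa :: h) = M.cost xa.1 xa.2 + M.pathCost h := by simp [pathCost]
    rw [this, List.length_cons]
    push_cast
    have := abs_add_le (M.cost xa.1 xa.2) (M.pathCost h)
    have := hC xa.1 xa.2
    linarith

theorem abs_pathCost_le_of_mem_support (hC : ∀ i a, |M.cost i a| ≤ C) (μ : PMF S)
    (π : M.Strategy) (t : ℕ) {h : M.Past × S} (hh : h ∈ (M.historyLaw μ π t).support) :
    |M.pathCost h.1| ≤ t * C := by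
  have := abs_pathCost_le hC h.1
  rwa [M.length_of_mem_support_historyLaw μ π t hh] at this

theorem abs_pathCost_add_le (hC : ∀ i a, |M.cost i a| ≤ C) (hV : ∀ i, |v i| ≤ V) (μ : PMF S)
    (π : M.Strategy) (t : ℕ) {h : M.Past × S} (hh : h ∈ (M.historyLaw μ π t).support) :
    |M.pathCost h.1 + v h.2| ≤ t * C + V :=
  (abs_add_le _ _).trans (add_le_add (abs_pathCost_le_of_mem_support hC μ π t hh) (hV _))

variable (M) in
/-- The expected cost of one step plus the expected value of `v` after it, from state `x`, when
the action is drawn from `q`. -/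
noncomputable def oneStep (v : S → ℝ) (x : S) (q : PMF (M.Action x)) : ℝ :=
  q.expect fun a => M.cost x a + (M.trans x a).expect v

theorem abs_cost_add_expect_le (hC : ∀ i a, |M.cost i a| ≤ C) (hV : ∀ i, |v i| ≤ V) (x : S)
    (a : M.Action x) : |M.cost x a + (M.trans x a).expect v| ≤ C + V :=
  (abs_add_le _ _).trans (add_le_add (hC x a) (PMF.abs_expect_le _ fun _ _ => hV _))

theorem abs_oneStep_le (hC : ∀ i a, |M.cost i a| ≤ C) (hV : ∀ i, |v i| ≤ V) (x : S)
    (q : PMF (M.Action x)) : |M.oneStep v x q| ≤ C + V :=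
  PMF.abs_expect_le _ fun a _ => abs_cost_add_expect_le hC hV x a

/-- Appending to the cost accumulated up to time `t + 1` the value `v` of the current state amounts
to replacing, at time `t`, the value of the state by its one-step cost-to-go. -/
theorem expect_historyLaw_succ (hC : ∀ i a, |M.cost i a| ≤ C) (hV : ∀ i, |v i| ≤ V) (μ : PMF S)
    (π : M.Strategy) (t : ℕ) :
    (M.historyLaw μ π (t + 1)).expect (fun h => M.pathCost h.1 + v h.2) =
      (M.historyLaw μ π t).expect fun h => M.pathCost h.1 + M.oneStep v h.2 (π h.1 h.2) := by
  have hb := fun h hh => abs_pathCost_add_le hC hV μ π (t + 1) (h := h) hh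
  rw [historyLaw] at hb ⊢
  rw [PMF.expect_bind _ _ hb]
  refine PMF.expect_congr _ fun h hh => ?_
  have hb' := fun k hk => hb k ((PMF.mem_support_bind_iff _ _ _).2 ⟨h, hh, hk⟩)
  rw [PMF.expect_bind _ _ hb', oneStep,
    ← PMF.expect_const_add _ _ fun a _ => abs_cost_add_expect_le hC hV h.2 a]
  refine PMF.expect_congr _ fun a ha => ?_
  have hb'' := fun k hk => hb' k ((PMF.mem_support_bind_iff _ _ _).2 ⟨a, ha, hk⟩)
  rw [PMF.expect_map _ _ hb'', ← add_assoc, ← PMF.expect_const_add _ _ fun y _ => hV y]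
  refine PMF.expect_congr _ fun y _ => ?_
  rw [pathCost_append]

theorem expectedCost_add (hC : ∀ i a, |M.cost i a| ≤ C) (hV : ∀ i, |v i| ≤ V) (μ : PMF S)
    (π : M.Strategy) (t : ℕ) :
    (M.historyLaw μ π t).expect (fun h => M.pathCost h.1 + v h.2) =
      M.expectedCost μ π t + (M.historyLaw μ π t).expect fun h => v h.2 :=
  PMF.expect_add _ (fun _ hh => abs_pathCost_le_of_mem_support hC μ π t hh) fun _ _ => hV _

theorem abs_expectedCost_le (hC : ∀ i a, |M.cost i a| ≤ C) (μ : PMF S) (π : M.Strategy) (t : ℕ) :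
    |M.expectedCost μ π t| ≤ t * C :=
  PMF.abs_expect_le (M.historyLaw μ π t) (f := fun h => M.pathCost h.1)
    fun _ hh => abs_pathCost_le_of_mem_support hC μ π t hh

variable {lam : ℝ}

theorem le_expectedCost (hC : ∀ i a, |M.cost i a| ≤ C) (hV : ∀ i, |v i| ≤ V) (μ : PMF S)
    (π : M.Strategy) (h : ∀ p x, v x + lam ≤ M.oneStep v x (π p x)) (t : ℕ) :
    t * lam - 2 * V ≤ M.expectedCost μ π t := by
  have key : t * lam - V ≤ (M.historyLaw μ π t).expect fun h => M.pathCost h.1 + v h.2 := by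
    induction t with
    | zero =>
      have := (abs_le.1 (PMF.abs_expect_le _ fun h hh =>
        abs_pathCost_add_le hC hV μ π 0 (h := h) hh)).1
      simp only [Nat.cast_zero, zero_mul, zero_add] at this ⊢
      linarith
    | succ t ih =>
      rw [expect_historyLaw_succ hC hV]
      have h1 : lam + (M.historyLaw μ π t).expect (fun h => M.pathCost h.1 + v h.2) ≤
          (M.historyLaw μ π t).expect
            fun h => M.pathCost h.1 + M.oneStep v h.2 (π h.1 h.2) := by
        rw [← PMF.expect_const_add _ _ fun h hh =>
          abs_pathCost_add_le hC hV μ π t (h := h) hh]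
        refine PMF.expect_mono _ (C := |lam| + (t * C + V)) (C' := t * C + (C + V))
          (fun k hk => (abs_add_le _ _).trans
            (add_le_add le_rfl (abs_pathCost_add_le hC hV μ π t hk)))
          (fun k hk => (abs_add_le _ _).trans
            (add_le_add (abs_pathCost_le_of_mem_support hC μ π t hk)
              (abs_oneStep_le hC hV _ _))) fun k _ => ?_
        have := h k.1 k.2
        linarith
      push_cast
      linarith
  rw [expectedCost_add hC hV] at key
  have := (abs_le.1 (PMF.abs_expect_le (M.historyLaw μ π t) (f := fun h => v h.2)
    fun _ _ => hV _)).2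
  linarith

theorem expectedCost_le (hC : ∀ i a, |M.cost i a| ≤ C) (hV : ∀ i, |v i| ≤ V) (μ : PMF S)
    (π : M.Strategy) (h : ∀ p x, M.oneStep v x (π p x) ≤ v x + lam) (t : ℕ) :
    M.expectedCost μ π t ≤ t * lam + 2 * V := by
  have key : (M.historyLaw μ π t).expect (fun h => M.pathCost h.1 + v h.2) ≤ t * lam + V := by
    induction t with
    | zero =>
      have := (abs_le.1 (PMF.abs_expect_le _ fun h hh =>
        abs_pathCost_add_le hC hV μ π 0 (h := h) hh)).2
      simp only [Nat.cast_zero, zero_mul, zero_add] at this ⊢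
      linarith
    | succ t ih =>
      rw [expect_historyLaw_succ hC hV]
      have h1 : (M.historyLaw μ π t).expect
            (fun h => M.pathCost h.1 + M.oneStep v h.2 (π h.1 h.2)) ≤
          lam + (M.historyLaw μ π t).expect (fun h => M.pathCost h.1 + v h.2) := by
        rw [← PMF.expect_const_add _ _ fun h hh =>
          abs_pathCost_add_le hC hV μ π t (h := h) hh]
        refine PMF.expect_mono _ (C' := |lam| + (t * C + V)) (C := t * C + (C + V))
          (fun k hk => (abs_add_le _ _).trans
            (add_le_add (abs_pathCost_le_of_mem_support hC μ π t hk)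
              (abs_oneStep_le hC hV _ _)))
          (fun k hk => (abs_add_le _ _).trans
            (add_le_add le_rfl (abs_pathCost_add_le hC hV μ π t hk))) fun k _ => ?_
        have := h k.1 k.2
        linarith
      push_cast
      linarith
  rw [expectedCost_add hC hV] at key
  have := (abs_le.1 (PMF.abs_expect_le (M.historyLaw μ π t) (f := fun h => v h.2)
    fun _ _ => hV _)).1
  linarith

theorem tendsto_average_bound (lam K : ℝ) :
    Filter.Tendsto (fun t : ℕ => 1 / (t : ℝ) * (t * lam + K)) Filter.atTop (nhds lam) := by
  have h1 : Filter.Tendsto (fun t : ℕ => lam + K / (t : ℝ)) Filter.atTop (nhds (lam + 0)) :=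
    tendsto_const_nhds.add (tendsto_const_div_atTop_nhds_zero_nat K)
  rw [add_zero] at h1
  refine h1.congr' ?_
  filter_upwards [Filter.eventually_gt_atTop 0] with t ht
  have : (t : ℝ) ≠ 0 := by positivity
  field_simp

/-- The lower half of the verification theorem. The accumulated cost exceeds `t * lam` up to a
bounded boundary term `v X₀ - v X_t`, which disappears in the time average. -/
theorem le_averageCost (hC : ∀ i a, |M.cost i a| ≤ C) (hV : ∀ i, |v i| ≤ V) (μ : PMF S)
    (π : M.Strategy) (h : ∀ p x, v x + lam ≤ M.oneStep v x (π p x)) :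
    lam ≤ M.averageCost μ π := by
  -- A real `limsup` is monotone only on sequences that are bounded above.
  have hb : ∀ t : ℕ, |1 / (t : ℝ) * M.expectedCost μ π t| ≤ |C| := by
    intro t
    rcases Nat.eq_zero_or_pos t with rfl | ht
    · simp
    have ht' : (0 : ℝ) < t := by exact_mod_cast ht
    rw [abs_mul, abs_of_pos (by positivity : 0 < 1 / (t : ℝ)), one_div, inv_mul_le_iff₀ ht']
    exact (abs_expectedCost_le hC μ π t).trans (by gcongr; exact le_abs_self C)
  have hl := tendsto_average_bound lam (-(2 * V))
  rw [← hl.limsup_eq]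
  refine Filter.limsup_le_limsup (Filter.Eventually.of_forall fun t => ?_)
    hl.isCoboundedUnder_le
    (Filter.isBoundedUnder_of ⟨|C|, fun t => (abs_le.1 (hb t)).2⟩)
  refine mul_le_mul_of_nonneg_left ?_ (by positivity)
  have := le_expectedCost hC hV μ π h t
  linarith

theorem averageCost_eq (hC : ∀ i a, |M.cost i a| ≤ C) (hV : ∀ i, |v i| ≤ V) (μ : PMF S)
    (π : M.Strategy) (h : ∀ p x, M.oneStep v x (π p x) = v x + lam) :
    M.averageCost μ π = lam := by
  refine (tendsto_of_tendsto_of_tendsto_of_le_of_le (tendsto_average_bound lam (-(2 * V)))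
    (tendsto_average_bound lam (2 * V)) (fun t => ?_) fun t => ?_).limsup_eq
  · refine mul_le_mul_of_nonneg_left ?_ (by positivity)
    have := le_expectedCost hC hV μ π (fun p x => (h p x).ge) t
    linarith
  · exact mul_le_mul_of_nonneg_left (expectedCost_le hC hV μ π (fun p x => (h p x).le) t)
      (by positivity)

/-- A lower bound for the one-step cost of every action passes to randomized actions. -/
theorem le_oneStep (hC : ∀ i a, |M.cost i a| ≤ C) (hV : ∀ i, |v i| ≤ V) {x : S} {r : ℝ}
    (h : ∀ a, r ≤ M.cost x a + (M.trans x a).expect v) (q : PMF (M.Action x)) :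
    r ≤ M.oneStep v x q := by
  rw [← q.expect_const r]
  exact q.expect_mono (C := |r|) (fun _ _ => le_rfl)
    (fun a _ => abs_cost_add_expect_le hC hV x a) fun a _ => h a

theorem isOptimal_of_oneStep_eq (hC : ∀ i a, |M.cost i a| ≤ C) (hV : ∀ i, |v i| ≤ V)
    (h : ∀ x a, v x + lam ≤ M.cost x a + (M.trans x a).expect v) {π : M.Strategy}
    (hπ : ∀ p x, M.oneStep v x (π p x) = v x + lam) : M.IsOptimal π := fun μ π' => by
  rw [averageCost_eq hC hV μ π hπ]
  exact le_averageCost hC hV μ π' fun p x => le_oneStep hC hV (h x) _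

theorem isValue_of_oneStep_eq (hC : ∀ i a, |M.cost i a| ≤ C) (hV : ∀ i, |v i| ≤ V)
    (h : ∀ x a, v x + lam ≤ M.cost x a + (M.trans x a).expect v) {π : M.Strategy}
    (hπ : ∀ p x, M.oneStep v x (π p x) = v x + lam) : M.IsValue lam := fun μ => by
  refine IsLeast.isGLB ⟨⟨π, averageCost_eq hC hV μ π hπ⟩, ?_⟩
  rintro _ ⟨π', rfl⟩
  exact le_averageCost hC hV μ π' fun p x => le_oneStep hC hV (h x) _

theorem oneStep_pure (x : S) (a : M.Action x) :
    M.oneStep v x (PMF.pure a) = M.cost x a + (M.trans x a).expect v :=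
  PMF.expect_pure _ _

end MarkovDecision
/-! ### Solving the ergodic equation by vanishing discount -/

section ErgodicEquation

variable {S : Type*} [Fintype S] {T : (S → ℝ) → S → ℝ}

theorem lipschitzWith_of_monotone_of_map_add (hmono : Monotone T)
    (hadd : ∀ (v : S → ℝ) (c : ℝ) (i : S), T (fun j => v j + c) i = T v i + c) :
    LipschitzWith 1 T := by
  have key : ∀ v w i, T v i - T w i ≤ dist v w := by
    intro v w i
    have h1 : v ≤ fun j => w j + dist v w := fun j => by
      have := (abs_le.1 ((Real.dist_eq (v j) (w j)).symm.trans_le (dist_le_pi_dist v w j))).2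
      linarith
    have h2 := hmono h1 i
    rw [hadd] at h2
    linarith
  refine LipschitzWith.of_dist_le_mul fun v w => ?_
  rw [NNReal.coe_one, one_mul, dist_pi_le_iff dist_nonneg]
  intro i
  rw [Real.dist_eq, abs_le]
  have h1 := key v w i
  have h2 := key w v i
  rw [dist_comm] at h2
  constructor <;> linarith

/-- The discounted problem, normalized at the state `i₀`. The bound on the relative values does
not depend on the discount factor: the reachability hypothesis `hreach` bounds their span. -/
theorem exists_relative_discounted_solution [Nonempty S] (hmono : Monotone T)
    (hadd : ∀ (v : S → ℝ) (c : ℝ) (i : S), T (fun j => v j + c) i = T v i + c)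
    {C ε K : ℝ} (hε : 0 < ε)
    (hreach : ∀ (v : S → ℝ) (m : ℝ), (∀ k, v k ≤ m) →
      ∀ i j, T v i ≤ C + ε * v j + (1 - ε) * m)
    (hK : ∀ i, -K ≤ T 0 i) (i₀ : S) {δ : ℝ} (hδ : 1 / 2 ≤ δ) (hδ1 : δ < 1) :
    ∃ u : S → ℝ, (∀ i, |u i| ≤ 2 * (C + K) / ε) ∧
      ∀ i, u i + T (fun j => δ * u j) i₀ = T (fun j => δ * u j) i := by
  have hT := lipschitzWith_of_monotone_of_map_add hmono hadd
  have hδ0 : 0 < δ := by linarith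
  have hc : ContractingWith δ.toNNReal fun v : S → ℝ => T (δ • v) := by
    refine ⟨Real.toNNReal_lt_one.2 hδ1, LipschitzWith.of_dist_le_mul fun v w => ?_⟩
    refine (hT.dist_le_mul _ _).trans ?_
    rw [NNReal.coe_one, one_mul, dist_smul₀, Real.norm_of_nonneg hδ0.le,
      Real.coe_toNNReal _ hδ0.le]
  set v : S → ℝ := ContractingWith.fixedPoint _ hc with hv
  have hfix : T (δ • v) = v := hc.fixedPoint_isFixedPt
  obtain ⟨iM, hM⟩ := Finite.exists_max v
  obtain ⟨im, hm⟩ := Finite.exists_min v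
  -- Only the scaled values `(1 - δ) * v i` are bounded below, uniformly in `δ`.
  have hlow : -K ≤ (1 - δ) * v im := by
    have h1 : (fun j => (0 : S → ℝ) j + δ * v im) ≤ δ • v := fun j => by
      simpa using mul_le_mul_of_nonneg_left (hm j) hδ0.le
    have h2 := hmono h1 im
    rw [hadd, hfix] at h2
    linarith [hK im]
  have hspan : v iM - v im ≤ 2 * (C + K) / ε := by
    have h1 := hreach (δ • v) (δ * v iM)
      (fun k => mul_le_mul_of_nonneg_left (hM k) hδ0.le) iM im
    rw [hfix, Pi.smul_apply, smul_eq_mul] at h1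
    have h2 : (1 - δ) * v im ≤ (1 - δ) * v iM :=
      mul_le_mul_of_nonneg_left (hM im) (by linarith)
    have h3 : δ * (ε * (v iM - v im)) ≤ C + K := by linarith
    have h4 : 1 / 2 * (ε * (v iM - v im)) ≤ δ * (ε * (v iM - v im)) :=
      mul_le_mul_of_nonneg_right hδ (mul_nonneg hε.le (by linarith [hM im]))
    rw [le_div_iff₀ hε]
    linarith
  refine ⟨fun i => v i - v i₀, fun i => ?_, fun i => ?_⟩
  · rw [abs_le]
    have := hM i; have := hM i₀; have := hm i; have := hm i₀
    constructor <;> linarith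
  · have h1 : (fun j => δ * (v j - v i₀)) = fun j => (δ • v) j + -(δ * v i₀) := by
      funext j; simp only [Pi.smul_apply, smul_eq_mul]; ring
    rw [h1, hadd, hadd, hfix]
    ring

/-- A monotone operator that commutes with the addition of constants, and in which every state
gets a definite share of the value of every other state, has an additive eigenvector. -/
theorem exists_additive_eigenvector [Nonempty S] (hmono : Monotone T)
    (hadd : ∀ (v : S → ℝ) (c : ℝ) (i : S), T (fun j => v j + c) i = T v i + c)
    {C ε : ℝ} (hε : 0 < ε)
    (hreach : ∀ (v : S → ℝ) (m : ℝ), (∀ k, v k ≤ m) →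
      ∀ i j, T v i ≤ C + ε * v j + (1 - ε) * m) :
    ∃ (v : S → ℝ) (lam : ℝ), ∀ i, T v i = v i + lam := by
  let i₀ : S := Classical.arbitrary S
  obtain ⟨im, hm⟩ := Finite.exists_min (T 0)
  have hK : ∀ i, -(-T 0 im) ≤ T 0 i := fun i => by rw [neg_neg]; exact hm i
  set δ : ℕ → ℝ := fun k => 1 - 1 / 2 * (1 / ((k : ℝ) + 1)) with hδ
  have hpos : ∀ k : ℕ, 0 < 1 / ((k : ℝ) + 1) := fun k => Nat.one_div_pos_of_nat
  have hle : ∀ k : ℕ, 1 / ((k : ℝ) + 1) ≤ 1 := fun k => by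
    rw [div_le_one (by positivity)]; linarith [(Nat.cast_nonneg k : (0 : ℝ) ≤ k)]
  choose u hu hfix using fun k => exists_relative_discounted_solution hmono hadd hε hreach hK i₀
    (δ := δ k) (by simp only [hδ]; linarith [hle k]) (by simp only [hδ]; linarith [hpos k])
  set R := 2 * (C + -T 0 im) / ε
  -- A limit point, as the discount factors `δ k` tend to `1`, of the bounded relative values.
  have hcomp : IsCompact (Set.univ.pi fun _ : S => Set.Icc (-R) R) :=
    isCompact_univ_pi fun _ => isCompact_Icc
  obtain ⟨w, -, φ, hφ, hlim⟩ := hcomp.tendsto_subseq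
    (x := u) fun k => Set.mem_univ_pi.2 fun i => abs_le.1 (hu k i)
  have hδlim : Filter.Tendsto δ Filter.atTop (nhds 1) := by
    have := (tendsto_one_div_add_atTop_nhds_zero_nat (𝕜 := ℝ)).const_mul (1 / 2 : ℝ)
    simpa [hδ] using this.const_sub 1
  have hsc : Filter.Tendsto (fun k => fun j => δ (φ k) * u (φ k) j) Filter.atTop (nhds w) := by
    rw [tendsto_pi_nhds] at hlim ⊢
    intro j
    simpa using (hδlim.comp hφ.tendsto_atTop).mul (hlim j)
  have hTlim := ((lipschitzWith_of_monotone_of_map_add hmono hadd).continuous.tendsto w).comp hsc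
  rw [tendsto_pi_nhds] at hlim hTlim
  refine ⟨w, T w i₀, fun i => ?_⟩
  refine tendsto_nhds_unique (hTlim i) (((hlim i).add (hTlim i₀)).congr fun k => ?_)
  exact hfix (φ k) i

end ErgodicEquation
/-! ### The polytopes as convex hulls of the link and teleportation choices -/

/-- A point that no linear functional separates from the finite family `f` is a convex combination
of it. -/
theorem exists_mem_stdSimplex_sum_smul_eq {ι E : Type*} [Fintype ι] [NormedAddCommGroup E]
    [NormedSpace ℝ E] (f : ι → E) (x : E) (h : ∀ l : E →L[ℝ] ℝ, ∃ b, l (f b) ≤ l x) :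
    ∃ w ∈ stdSimplex ℝ ι, ∑ b, w b • f b = x := by
  classical
  by_contra hx
  have hcont : Continuous (Fintype.linearCombination ℝ f) :=
    LinearMap.continuous_of_finiteDimensional _
  have hK : IsCompact (Fintype.linearCombination ℝ f '' stdSimplex ℝ ι) :=
    (isCompact_stdSimplex ℝ ι).image hcont
  obtain ⟨l, u, hlx, hlu⟩ := geometric_hahn_banach_point_closed
    ((convex_stdSimplex ℝ ι).linear_image (Fintype.linearCombination ℝ f)) hK.isClosed
    (x := x) (by
      rintro ⟨w, hw, hwx⟩
      exact hx ⟨w, hw, by rw [← hwx, Fintype.linearCombination_apply]⟩)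
  obtain ⟨b, hb⟩ := h l
  have := hlu (f b) ⟨Pi.single b 1, single_mem_stdSimplex ℝ b, by
    simp [Fintype.linearCombination_apply_single]⟩
  linarith

namespace WebModel

variable {n : ℕ}

/-- The greedy choice: the uniform law on the `d` elements of `F` with the smallest weights `g`
minimizes the average weight among the laws on `F` with entries at most `1 / d`. The laws are scaled
here by a total mass `s`, and one set serves all `s`. -/
theorem exists_subset_card_eq_sum_zOf_le (F : Finset (Fin n)) {d : ℕ} (hd : d ≠ 0)
    (hdF : d ≤ F.card) (g : Fin n → ℝ) :
    ∃ J ⊆ F, J.card = d ∧ ∀ (s : ℝ) (w : Fin n → ℝ), (∀ j ∉ F, w j = 0) →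
      (∀ j ∈ F, 0 ≤ w j ∧ w j ≤ s / d) → ∑ j, w j = s →
      s * ∑ j, zOf J j * g j ≤ ∑ j, w j * g j := by
  obtain ⟨J, hJ, hmin⟩ := Finset.exists_min_image (F.powersetCard d) (fun J => ∑ j ∈ J, g j)
    (Finset.powersetCard_nonempty.2 hdF)
  rw [Finset.mem_powersetCard] at hJ
  have hne : J.Nonempty := by rw [← Finset.card_ne_zero, hJ.2]; exact hd
  obtain ⟨m, hm, hmax⟩ := Finset.exists_max_image J g hne
  have hout : ∀ k ∈ F, k ∉ J → g m ≤ g k := by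
    intro k hkF hkJ
    have hk : k ∉ J.erase m := fun h => hkJ (Finset.mem_of_mem_erase h)
    have h1 := hmin (insert k (J.erase m)) (by
      rw [Finset.mem_powersetCard]
      refine ⟨Finset.insert_subset hkF ((Finset.erase_subset _ _).trans hJ.1), ?_⟩
      rw [Finset.card_insert_of_notMem hk, Finset.card_erase_add_one hm, hJ.2])
    rw [Finset.sum_insert hk] at h1
    have h2 := Finset.add_sum_erase J g hm
    linarith
  refine ⟨J, hJ.1, hJ.2, fun s w hw0 hw hs => ?_⟩
  have hz : ∑ j, zOf J j = 1 := sum_zOf J (by rw [hJ.2]; exact hd)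
  have key : 0 ≤ ∑ j, (g j - g m) * (w j - s * zOf J j) := by
    refine Finset.sum_nonneg fun j _ => ?_
    by_cases hjF : j ∈ F
    · by_cases hjJ : j ∈ J
      · refine mul_nonneg_of_nonpos_of_nonpos (sub_nonpos.2 (hmax j hjJ)) (sub_nonpos.2 ?_)
        rw [zOf, if_pos hjJ, hJ.2, ← div_eq_mul_inv]
        exact (hw j hjF).2
      · refine mul_nonneg (sub_nonneg.2 (hout j hjF hjJ)) ?_
        rw [zOf, if_neg hjJ, mul_zero, sub_zero]
        exact (hw j hjF).1
    · rw [hw0 j hjF, zOf, if_neg fun h => hjF (hJ.1 h)]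
      simp
  have hexp : ∑ j, (g j - g m) * (w j - s * zOf J j) =
      ∑ j, w j * g j - s * ∑ j, zOf J j * g j - g m * (∑ j, w j - s * ∑ j, zOf J j) := by
    simp only [Finset.mul_sum, ← Finset.sum_sub_distrib]
    exact Finset.sum_congr rfl fun j _ => by ring
  rw [hexp, hs, hz] at key
  linarith

variable (M : WebModel n)

theorem zOf_mem_Z {I : Finset (Fin n)} (hI : I.card = M.N) : zOf I ∈ M.Z := by
  refine ⟨sum_zOf I (M.card_ne_zero hI), fun i => ⟨zOf_nonneg I i, ?_⟩⟩
  rw [zOf, hI]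
  split_ifs
  · rw [one_div]
  · positivity

theorem sum_sigmaOf_mul {x : Fin n} {J : Finset (Fin n)} (hJ : J ⊆ M.F x)
    (h : Fin (M.D x + 1) → ℝ) :
    ∑ d, M.sigmaOf x J d * h d = h ⟨J.card, Nat.lt_succ_of_le (Finset.card_le_card hJ)⟩ := by
  rw [Finset.sum_eq_single ⟨J.card, Nat.lt_succ_of_le (Finset.card_le_card hJ)⟩]
  · simp [sigmaOf]
  · intro d _ hd
    rw [sigmaOf, if_neg fun h => hd (Fin.ext h), zero_mul]
  · simp

theorem sum_sigmaOf {x : Fin n} {J : Finset (Fin n)} (hJ : J ⊆ M.F x) :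
    ∑ d, M.sigmaOf x J d = 1 := by
  simpa using M.sum_sigmaOf_mul hJ fun _ => 1

theorem mem_P_of_admissible {x : Fin n} {I J : Finset (Fin n)} (h : M.Admissible x I J) :
    (M.sigmaOf x J, nuOf I J) ∈ M.P x := by
  have hσ : ∀ d, 0 ≤ M.sigmaOf x J d := fun d => by unfold sigmaOf; split_ifs <;> norm_num
  refine ⟨fun d j => M.sigmaOf x J d * nuOf I J j, M.sum_sigmaOf h.2, hσ, fun j => ?_, fun d => ?_,
    fun j => ⟨mul_nonneg (hσ 0) (nuOf_nonneg I J j), ?_⟩, fun j hj d hd => ?_,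
    fun j hj d hd => ⟨mul_nonneg (hσ d) (nuOf_nonneg I J j), ?_⟩⟩
  · rw [← Finset.sum_mul, M.sum_sigmaOf h.2, one_mul]
  · rw [← Finset.mul_sum, sum_nuOf I J (M.card_ne_zero h.1), mul_one]
  · by_cases hJ : J = ∅
    · change M.sigmaOf x J 0 * nuOf I J j ≤ M.sigmaOf x J 0 / M.N
      rw [div_eq_mul_one_div, nuOf, if_pos hJ]
      exact mul_le_mul_of_nonneg_left ((M.zOf_mem_Z h.1).2 j).2 (hσ 0)
    · have h0 : M.sigmaOf x J 0 = 0 := by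
        rw [sigmaOf, if_neg]
        exact fun h0 => hJ (Finset.card_eq_zero.1 h0.symm)
      simp [h0]
  all_goals
    by_cases hdJ : (d : ℕ) = J.card
    · have hJ : J ≠ ∅ := by
        rintro rfl
        exact hd (Fin.ext (by simpa using hdJ))
      simp only [nuOf, if_neg hJ]
      split_ifs with hjJ
      · first
        | exact absurd (h.2 hjJ) hj
        | rw [hdJ, div_eq_mul_inv]
      · first
        | exact mul_zero _
        | rw [mul_zero]
          exact div_nonneg (hσ d) (Nat.cast_nonneg _)
    · simp [sigmaOf, hdJ]

theorem relaxedCost_eq_sum {x : Fin n} {σ : Fin (M.D x + 1) → ℝ} (h1 : ∑ d, σ d = 1)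
    {J : Fin (M.D x + 1) → Finset (Fin n)} (hJ : ∀ d, (J d).card = d) :
    M.relaxedCost x σ = ∑ d, σ d * M.linkCost x (J d) := by
  have h2 : ∀ d, σ d * M.linkCost x (J d) = M.c' x * σ d +
      M.γ / M.D x * (M.D x * σ d - (d : ℕ) * σ d) := fun d => by
    rw [linkCost, hJ]; ring
  simp only [h2, Finset.sum_add_distrib, ← Finset.mul_sum, Finset.sum_sub_distrib, h1, relaxedCost]
  ring

theorem relaxedCost_sigmaOf {x : Fin n} {J : Finset (Fin n)} (hJ : J ⊆ M.F x) :
    M.relaxedCost x (M.sigmaOf x J) = M.linkCost x J := by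
  have := M.sum_sigmaOf_mul hJ fun d => ((d : ℕ) : ℝ)
  simp only [mul_comm (M.sigmaOf x J _)] at this
  rw [relaxedCost, linkCost, this]

/-- No linear functional, with weight `κ` on the cost and weights `g` on the transition
probabilities, is smaller at a relaxed action than at all link and teleportation choices. The same
set `I` of smallest weights serves for `z` and for the row `w⁰`, so the coupling of the two in the
original actions costs nothing. -/
theorem exists_action_le (κ : ℝ) (g : Fin n → ℝ) {x : Fin n} {σ : Fin (M.D x + 1) → ℝ}
    {ν z : Fin n → ℝ} (hp : (σ, ν) ∈ M.P x) (hz : z ∈ M.Z) :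
    ∃ b : M.maxRank.Action x, κ * M.linkCost x b.1.2 +
        ∑ j, (M.α * nuOf b.1.1 b.1.2 j + (1 - M.α) * zOf b.1.1 j) * g j ≤
      κ * M.relaxedCost x σ + ∑ j, (M.α * ν j + (1 - M.α) * z j) * g j := by
  obtain ⟨w, h1, hσ, hν, hrow, hw0, hwF, hw⟩ := hp
  simp only at h1 hσ hν hrow hw0 hw
  obtain ⟨I, -, hI, hImin⟩ := exists_subset_card_eq_sum_zOf_le Finset.univ
    (Nat.one_le_iff_ne_zero.1 M.N_pos) (by simpa using M.N_le) g
  have hJ : ∀ d : Fin (M.D x + 1), ∃ J ⊆ M.F x, J.card = d ∧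
      σ d * ∑ j, nuOf I J j * g j ≤ ∑ j, w d j * g j := by
    intro d
    by_cases hd : d = 0
    · subst hd
      refine ⟨∅, Finset.empty_subset _, by simp, ?_⟩
      simp only [nuOf, if_true]
      exact hImin _ _ (fun j hj => absurd (Finset.mem_univ j) hj) (fun j _ => hw0 j) (hrow 0)
    · have hd' : (d : ℕ) ≠ 0 := fun h => hd (Fin.ext h)
      obtain ⟨J, hJF, hJc, hJmin⟩ := exists_subset_card_eq_sum_zOf_le (M.F x) hd'
        (Nat.lt_succ_iff.1 d.2) g
      refine ⟨J, hJF, hJc, ?_⟩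
      have hne : J ≠ ∅ := by
        rintro rfl
        exact hd' (by simpa using hJc.symm)
      simp only [nuOf, if_neg hne]
      exact hJmin _ _ (fun j hj => hwF j hj d hd) (fun j hj => hw j hj d hd) (hrow d)
  choose J hJF hJc hJmin using hJ
  obtain ⟨d₀, hd₀⟩ := Finite.exists_min fun d =>
    κ * M.linkCost x (J d) + ∑ j, (M.α * nuOf I (J d) j + (1 - M.α) * zOf I j) * g j
  refine ⟨⟨(I, J d₀), hI, hJF d₀⟩, ?_⟩
  have hsplit : ∀ a b : Fin n → ℝ, ∑ j, (M.α * a j + (1 - M.α) * b j) * g j =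
      M.α * ∑ j, a j * g j + (1 - M.α) * ∑ j, b j * g j := fun a b => by
    simp only [Finset.mul_sum, ← Finset.sum_add_distrib]
    exact Finset.sum_congr rfl fun j _ => by ring
  have hterm : ∀ d, σ d * (κ * M.linkCost x (J d) +
      ∑ j, (M.α * nuOf I (J d) j + (1 - M.α) * zOf I j) * g j) =
      κ * (σ d * M.linkCost x (J d)) + (M.α * (σ d * ∑ j, nuOf I (J d) j * g j) +
        (1 - M.α) * (σ d * ∑ j, zOf I j * g j)) := fun d => by
    rw [hsplit]; ring
  have hzI : ∑ j, zOf I j * g j ≤ ∑ j, z j * g j := by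
    have := hImin 1 z (fun j hj => absurd (Finset.mem_univ j) hj) (fun j _ => hz.2 j) hz.1
    rwa [one_mul] at this
  have hνg : ∑ j, ν j * g j = ∑ d, ∑ j, w d j * g j := by
    simp only [hν, Finset.sum_mul]
    exact Finset.sum_comm
  -- The least of the values indexed by `d` is at most their average with the weights `σ d`.
  calc κ * M.linkCost x (J d₀) + ∑ j, (M.α * nuOf I (J d₀) j + (1 - M.α) * zOf I j) * g j
      = ∑ d, σ d * (κ * M.linkCost x (J d₀) +
          ∑ j, (M.α * nuOf I (J d₀) j + (1 - M.α) * zOf I j) * g j) := by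
        rw [← Finset.sum_mul, h1, one_mul]
    _ ≤ ∑ d, σ d * (κ * M.linkCost x (J d) +
          ∑ j, (M.α * nuOf I (J d) j + (1 - M.α) * zOf I j) * g j) :=
        Finset.sum_le_sum fun d _ => mul_le_mul_of_nonneg_left (hd₀ d) (hσ d)
    _ = κ * ∑ d, σ d * M.linkCost x (J d) + (M.α * ∑ d, σ d * ∑ j, nuOf I (J d) j * g j +
          (1 - M.α) * ((∑ d, σ d) * ∑ j, zOf I j * g j)) := by
        simp only [hterm, Finset.sum_add_distrib, ← Finset.mul_sum, ← Finset.sum_mul]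
    _ ≤ κ * M.relaxedCost x σ + ∑ j, (M.α * ν j + (1 - M.α) * z j) * g j := by
        rw [hsplit, hνg, h1, one_mul, M.relaxedCost_eq_sum h1 hJc]
        exact add_le_add le_rfl (add_le_add
          (mul_le_mul_of_nonneg_left (Finset.sum_le_sum fun d _ => hJmin d) M.α_nonneg)
          (mul_le_mul_of_nonneg_left hzI (sub_nonneg.2 M.α_le_one)))

end WebModel
namespace WebModel

variable {n : ℕ} (M : WebModel n)

/-! ### The two control problems -/

theorem mixPMF_toReal {α : ℝ} {ν z : Fin n → ℝ} (h0 : ∀ j, 0 ≤ α * ν j + (1 - α) * z j)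
    (h1 : ∑ j, (α * ν j + (1 - α) * z j) = 1) (j : Fin n) :
    (mixPMF α ν z h0 h1 j).toReal = α * ν j + (1 - α) * z j := by
  rw [mixPMF, PMF.ofFintype_apply, ENNReal.toReal_ofReal (h0 j)]

theorem expect_mixPMF {α : ℝ} {ν z : Fin n → ℝ} (h0 : ∀ j, 0 ≤ α * ν j + (1 - α) * z j)
    (h1 : ∑ j, (α * ν j + (1 - α) * z j) = 1) (v : Fin n → ℝ) :
    (mixPMF α ν z h0 h1).expect v = ∑ j, (α * ν j + (1 - α) * z j) * v j := by
  rw [PMF.expect, tsum_fintype]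
  exact Finset.sum_congr rfl fun j _ => by rw [mixPMF_toReal]

theorem maxRank_cost_add_expect (v : Fin n → ℝ) (x : Fin n) (b : M.maxRank.Action x) :
    M.maxRank.cost x b + (M.maxRank.trans x b).expect v =
      M.linkCost x b.1.2 + ∑ j, (M.α * nuOf b.1.1 b.1.2 j + (1 - M.α) * zOf b.1.1 j) * v j :=
  congrArg (M.linkCost x b.1.2 + ·) (expect_mixPMF
    (M.mix_nonneg (nuOf_nonneg _ _) (zOf_nonneg _))
    (M.mix_sum (sum_nuOf _ _ (M.card_ne_zero b.2.1)) (sum_zOf _ (M.card_ne_zero b.2.1))) v)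

theorem maxRank_eq_bellman (v : Fin n → ℝ) (x : Fin n) (b : M.maxRank.Action x) :
    M.maxRank.cost x b + (M.maxRank.trans x b).expect v =
      M.bellman v x (M.sigmaOf x b.1.2) (nuOf b.1.1 b.1.2) (zOf b.1.1) := by
  rw [maxRank_cost_add_expect, bellman, M.relaxedCost_sigmaOf b.2.2]

theorem relaxed_eq_bellman (v : Fin n → ℝ) (x : Fin n) (a : M.relaxed.Action x) :
    M.relaxed.cost x a + (M.relaxed.trans x a).expect v =
      M.bellman v x a.1.1.1 a.1.1.2 a.1.2 :=
  congrArg (M.relaxedCost x a.1.1.1 + ·) (expect_mixPMF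
    (M.mix_nonneg (M.nonneg_of_mem_P a.2.1) fun j => (a.2.2.2 j).1)
    (M.mix_sum (M.sum_of_mem_P a.2.1) a.2.2.1) v)

instance finite_maxRank_action (x : Fin n) : Finite (M.maxRank.Action x) :=
  inferInstanceAs (Finite {a : Finset (Fin n) × Finset (Fin n) // M.Admissible x a.1 a.2})

/-- Teleportation to a set that contains a given page `j`, with all hyperlinks removed. -/
theorem exists_action_mem (x j : Fin n) :
    ∃ b : M.maxRank.Action x, j ∈ b.1.1 ∧ b.1.2 = ∅ := by
  obtain ⟨I, hjI, -, hI⟩ := Finset.exists_subsuperset_card_eq (Finset.subset_univ {j})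
    (by simpa using M.N_pos) (by simpa using M.N_le)
  exact ⟨⟨(I, ∅), hI, Finset.empty_subset _⟩, hjI (Finset.mem_singleton_self j), rfl⟩

instance nonempty_maxRank_action (x : Fin n) : Nonempty (M.maxRank.Action x) :=
  ⟨(M.exists_action_mem x x).choose⟩

/-- The penalty lies between `0` and `γ`, also in a page without hyperlinks, where the quotient by
`D_x = 0` is `0`. -/
theorem abs_relaxedCost_le {x : Fin n} {p : (Fin (M.D x + 1) → ℝ) × (Fin n → ℝ)}
    (hp : p ∈ M.P x) : |M.relaxedCost x p.1| ≤ |M.c' x| + M.γ := by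
  obtain ⟨w, h1, hσ, -⟩ := hp
  have hs0 : 0 ≤ ∑ d : Fin (M.D x + 1), ((d : ℕ) : ℝ) * p.1 d :=
    Finset.sum_nonneg fun d _ => mul_nonneg (Nat.cast_nonneg _) (hσ d)
  have hs1 : ∑ d : Fin (M.D x + 1), ((d : ℕ) : ℝ) * p.1 d ≤ M.D x := by
    calc _ ≤ ∑ d, (M.D x : ℝ) * p.1 d := Finset.sum_le_sum fun d _ =>
          mul_le_mul_of_nonneg_right (by exact_mod_cast Nat.lt_succ_iff.1 d.2) (hσ d)
      _ = M.D x := by rw [← Finset.mul_sum, h1, mul_one]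
  have hf0 : 0 ≤ ((M.D x : ℝ) - ∑ d : Fin (M.D x + 1), ((d : ℕ) : ℝ) * p.1 d) / (M.D x : ℝ) :=
    div_nonneg (by linarith) (Nat.cast_nonneg _)
  have hf1 : ((M.D x : ℝ) - ∑ d : Fin (M.D x + 1), ((d : ℕ) : ℝ) * p.1 d) / (M.D x : ℝ) ≤ 1 :=
    div_le_one_of_le₀ (by linarith) (Nat.cast_nonneg _)
  refine (abs_add_le _ _).trans (add_le_add le_rfl ?_)
  rw [abs_of_nonneg (mul_nonneg M.γ_pos.le hf0)]
  exact mul_le_of_le_one_right M.γ_pos.le hf1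

theorem exists_bound_relaxed_cost : ∃ C, ∀ x a, |M.relaxed.cost x a| ≤ C :=
  ⟨∑ i, |M.c' i| + M.γ, fun x a => (M.abs_relaxedCost_le a.2.1).trans (add_le_add
    (Finset.single_le_sum (fun i _ => abs_nonneg (M.c' i)) (Finset.mem_univ x)) le_rfl)⟩

theorem exists_bound_maxRank_cost : ∃ C, ∀ x b, |M.maxRank.cost x b| ≤ C := by
  obtain ⟨C, hC⟩ := M.exists_bound_relaxed_cost
  refine ⟨C, fun x b => ?_⟩
  have := hC x ⟨((M.sigmaOf x b.1.2, nuOf b.1.1 b.1.2), zOf b.1.1),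
    M.mem_P_of_admissible b.2, M.zOf_mem_Z b.2.1⟩
  change |M.relaxedCost x (M.sigmaOf x b.1.2)| ≤ C at this
  rwa [M.relaxedCost_sigmaOf b.2.2] at this

theorem exists_bound (v : Fin n → ℝ) : ∃ V, ∀ i, |v i| ≤ V :=
  ⟨∑ i, |v i|, fun i => Finset.single_le_sum (fun i _ => abs_nonneg (v i)) (Finset.mem_univ i)⟩

/-! ### Solutions of the dynamic programming equation -/

/-- The dynamic programming operator of the MaxRank problem. Each page has finitely many actions, so
the infimum is a minimum. -/
noncomputable def dpOperator (v : Fin n → ℝ) (x : Fin n) : ℝ :=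
  ⨅ b : M.maxRank.Action x,
    (M.linkCost x b.1.2 + ∑ j, (M.α * nuOf b.1.1 b.1.2 j + (1 - M.α) * zOf b.1.1 j) * v j)

theorem dpOperator_le (v : Fin n → ℝ) (x : Fin n) (b : M.maxRank.Action x) :
    M.dpOperator v x ≤
      M.linkCost x b.1.2 + ∑ j, (M.α * nuOf b.1.1 b.1.2 j + (1 - M.α) * zOf b.1.1 j) * v j :=
  ciInf_le (Set.finite_range _).bddBelow b

theorem exists_eq_dpOperator (v : Fin n → ℝ) (x : Fin n) : ∃ b : M.maxRank.Action x,
    M.linkCost x b.1.2 + ∑ j, (M.α * nuOf b.1.1 b.1.2 j + (1 - M.α) * zOf b.1.1 j) * v j =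
      M.dpOperator v x :=
  exists_eq_ciInf_of_finite

theorem dpOperator_mono : Monotone M.dpOperator := fun v w hvw x => by
  obtain ⟨b, hb⟩ := M.exists_eq_dpOperator w x
  rw [← hb]
  refine (M.dpOperator_le v x b).trans (add_le_add le_rfl (Finset.sum_le_sum fun j _ => ?_))
  exact mul_le_mul_of_nonneg_left (hvw j) (M.mix_nonneg (nuOf_nonneg _ _) (zOf_nonneg _) j)

theorem dpOperator_add_const (v : Fin n → ℝ) (c : ℝ) (x : Fin n) :
    M.dpOperator (fun j => v j + c) x = M.dpOperator v x + c := by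
  have h : ∀ b : M.maxRank.Action x,
      ∑ j, (M.α * nuOf b.1.1 b.1.2 j + (1 - M.α) * zOf b.1.1 j) * (v j + c) =
        ∑ j, (M.α * nuOf b.1.1 b.1.2 j + (1 - M.α) * zOf b.1.1 j) * v j + c := fun b => by
    have h1 := M.mix_sum (sum_nuOf b.1.1 b.1.2 (M.card_ne_zero b.2.1))
      (sum_zOf b.1.1 (M.card_ne_zero b.2.1))
    simp only [mul_add, Finset.sum_add_distrib] at h1 ⊢
    rw [← Finset.sum_mul, Finset.sum_add_distrib, h1, one_mul]
  apply le_antisymm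
  · obtain ⟨b, hb⟩ := M.exists_eq_dpOperator v x
    have := M.dpOperator_le (fun j => v j + c) x b
    rw [h] at this
    linarith
  · obtain ⟨b, hb⟩ := M.exists_eq_dpOperator (fun j => v j + c) x
    have := M.dpOperator_le v x b
    rw [h] at hb
    linarith

/-- Removing all hyperlinks of a page and teleporting uniformly to a set that contains `j` moves to
`j` with probability `1 / N`, whatever the damping factor. -/
theorem dpOperator_le_of_le (v : Fin n → ℝ) (m : ℝ) (hm : ∀ k, v k ≤ m) (i j : Fin n) :
    M.dpOperator v i ≤ ∑ k, |M.linkCost k ∅| + 1 / (M.N : ℝ) * v j + (1 - 1 / (M.N : ℝ)) * m := by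
  obtain ⟨b, hj, hb⟩ := M.exists_action_mem i j
  have h1 := M.dpOperator_le v i b
  have h2 : ∀ k, M.α * nuOf b.1.1 b.1.2 k + (1 - M.α) * zOf b.1.1 k = zOf b.1.1 k := fun k => by
    rw [nuOf, if_pos hb]; ring
  simp only [h2] at h1
  have h3 : ∑ k, zOf b.1.1 k * v k = m - ∑ k, zOf b.1.1 k * (m - v k) := by
    simp only [mul_sub, Finset.sum_sub_distrib, ← Finset.sum_mul,
      sum_zOf _ (M.card_ne_zero b.2.1)]
    ring
  have h4 : zOf b.1.1 j * (m - v j) ≤ ∑ k, zOf b.1.1 k * (m - v k) :=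
    Finset.single_le_sum (f := fun k => zOf b.1.1 k * (m - v k))
      (fun k _ => mul_nonneg (zOf_nonneg _ _) (sub_nonneg.2 (hm k))) (Finset.mem_univ j)
  have h5 : zOf b.1.1 j = 1 / (M.N : ℝ) := by rw [zOf, if_pos hj, b.2.1, one_div]
  rw [h5] at h4
  have h6 : M.linkCost i b.1.2 ≤ ∑ k, |M.linkCost k ∅| := by
    rw [hb]
    exact (le_abs_self _).trans (Finset.single_le_sum (f := fun k => |M.linkCost k ∅|)
      (fun k _ => abs_nonneg _) (Finset.mem_univ i))
  linarith

/-- Minimizing over `P_x × Z` gives the same values as minimizing over the pairs `(I, J)`. -/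
theorem isSolution_of_dpOperator_eq {v : Fin n → ℝ} {lam : ℝ}
    (h : ∀ i, M.dpOperator v i = v i + lam) : M.IsSolution v lam := fun i => by
  constructor
  · obtain ⟨b, hb⟩ := M.exists_eq_dpOperator v i
    refine ⟨_, _, _, M.mem_P_of_admissible b.2, M.zOf_mem_Z b.2.1, ?_⟩
    rw [bellman, M.relaxedCost_sigmaOf b.2.2, hb, h]
  · rintro _ ⟨σ, ν, z, hp, hz, rfl⟩
    obtain ⟨b, hle⟩ := M.exists_action_le 1 v hp hz
    rw [one_mul, one_mul] at hle
    rw [← h]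
    exact (M.dpOperator_le v i b).trans hle

theorem exists_isSolution : ∃ (v : Fin n → ℝ) (lam : ℝ), M.IsSolution v lam := by
  have : Nonempty (Fin n) := Fin.pos_iff_nonempty.1 (M.N_pos.trans M.N_le)
  have hN : (0 : ℝ) < M.N := by exact_mod_cast M.N_pos
  obtain ⟨v, lam, h⟩ := exists_additive_eigenvector M.dpOperator_mono M.dpOperator_add_const
    (one_div_pos.2 hN) M.dpOperator_le_of_le
  exact ⟨v, lam, M.isSolution_of_dpOperator_eq h⟩

variable {M} {v : Fin n → ℝ} {lam : ℝ}

theorem IsSolution.le_relaxed (h : M.IsSolution v lam) (x : Fin n) (a : M.relaxed.Action x) :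
    v x + lam ≤ M.relaxed.cost x a + (M.relaxed.trans x a).expect v := by
  rw [relaxed_eq_bellman]
  exact (h x).2 ⟨_, _, _, a.2.1, a.2.2, rfl⟩

theorem IsSolution.le_maxRank (h : M.IsSolution v lam) (x : Fin n) (b : M.maxRank.Action x) :
    v x + lam ≤ M.maxRank.cost x b + (M.maxRank.trans x b).expect v := by
  rw [maxRank_eq_bellman]
  exact (h x).2 ⟨_, _, _, M.mem_P_of_admissible b.2, M.zOf_mem_Z b.2.1, rfl⟩

theorem IsSolution.exists_minimizing (h : M.IsSolution v lam) :
    ∃ a : ∀ i, M.relaxed.Action i, M.Minimizing v lam a := by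
  choose σ ν z hp hz heq using fun i => (h i).1
  exact ⟨fun i => ⟨((σ i, ν i), z i), hp i, hz i⟩, fun i => (heq i).symm⟩

theorem IsSolution.exists_minimizingLinks (h : M.IsSolution v lam) :
    ∃ b : ∀ i, M.maxRank.Action i, M.MinimizingLinks v lam b := by
  have key : ∀ i, ∃ b : M.maxRank.Action i,
      M.maxRank.cost i b + (M.maxRank.trans i b).expect v = v i + lam := by
    intro i
    obtain ⟨σ, ν, z, hp, hz, heq⟩ := (h i).1
    obtain ⟨b, hle⟩ := M.exists_action_le 1 v hp hz
    rw [one_mul, one_mul] at hle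
    refine ⟨b, le_antisymm ?_ (h.le_maxRank i _)⟩
    rw [maxRank_cost_add_expect, heq]
    exact hle
  choose b hb using key
  exact ⟨b, fun i => ⟨M.mem_P_of_admissible (b i).2, M.zOf_mem_Z (b i).2.1, by
    rw [← maxRank_eq_bellman, hb]⟩⟩

theorem oneStep_relaxed_stationary {a : ∀ i, M.relaxed.Action i} (ha : M.Minimizing v lam a)
    (p : M.relaxed.Past) (x : Fin n) :
    M.relaxed.oneStep v x (M.relaxed.stationary a p x) = v x + lam := by
  rw [MarkovDecision.stationary, MarkovDecision.oneStep_pure, relaxed_eq_bellman, ha x]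

theorem oneStep_maxRank_stationary {b : ∀ i, M.maxRank.Action i}
    (hb : M.MinimizingLinks v lam b) (p : M.maxRank.Past) (x : Fin n) :
    M.maxRank.oneStep v x (M.maxRank.stationary b p x) = v x + lam := by
  rw [MarkovDecision.stationary, MarkovDecision.oneStep_pure, maxRank_eq_bellman, (hb x).2.2]

theorem IsSolution.isValue_maxRank (h : M.IsSolution v lam) : M.maxRank.IsValue lam := by
  obtain ⟨C, hC⟩ := M.exists_bound_maxRank_cost
  obtain ⟨V, hV⟩ := exists_bound v
  obtain ⟨b, hb⟩ := h.exists_minimizingLinks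
  exact MarkovDecision.isValue_of_oneStep_eq hC hV h.le_maxRank (oneStep_maxRank_stationary hb)

theorem IsSolution.isValue_relaxed (h : M.IsSolution v lam) : M.relaxed.IsValue lam := by
  obtain ⟨C, hC⟩ := M.exists_bound_relaxed_cost
  obtain ⟨V, hV⟩ := exists_bound v
  obtain ⟨a, ha⟩ := h.exists_minimizing
  exact MarkovDecision.isValue_of_oneStep_eq hC hV h.le_relaxed (oneStep_relaxed_stationary ha)

/-! ### Implementing relaxed actions by randomized link and teleportation choices -/

/-- The point (transition probabilities, cost) of a relaxed action is a convex combination of those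
of the link and teleportation choices, and the coefficients are the law of the randomized choice. -/
theorem exists_law_implementing (x : Fin n) (a : M.relaxed.Action x) :
    ∃ q : PMF (M.maxRank.Action x), q.bind (M.maxRank.trans x) = M.relaxed.trans x a ∧
      ∑' b, (q b).toReal * M.maxRank.cost x b = M.relaxed.cost x a := by
  classical
  let _ : Fintype (M.maxRank.Action x) := Fintype.ofFinite _
  obtain ⟨w, ⟨hw0, hw1⟩, hw⟩ := exists_mem_stdSimplex_sum_smul_eq
    (fun b : M.maxRank.Action x =>
      ((fun j => M.α * nuOf b.1.1 b.1.2 j + (1 - M.α) * zOf b.1.1 j, M.linkCost x b.1.2) :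
        (Fin n → ℝ) × ℝ))
    (fun j => M.α * a.1.1.2 j + (1 - M.α) * a.1.2 j, M.relaxedCost x a.1.1.1) (by
      intro l
      -- The coordinates of `l` are the weights on the cost and on the transition probabilities.
      have hl : ∀ (u : Fin n → ℝ) (c : ℝ),
          l (u, c) = l (0, 1) * c + ∑ j, u j * l (Pi.single j 1, 0) := by
        intro u c
        have h1 : (u, c) = c • ((0 : Fin n → ℝ), (1 : ℝ)) +
            ∑ j, u j • ((Pi.single j 1 : Fin n → ℝ), (0 : ℝ)) := by
          refine Prod.ext ?_ ?_
          · rw [Prod.fst_add, Prod.fst_sum]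
            funext k
            simp [Finset.sum_apply, Pi.single_apply]
          · rw [Prod.snd_add, Prod.snd_sum]
            simp
        conv_lhs => rw [h1]
        simp only [map_add, map_sum, map_smul, smul_eq_mul]
        rw [mul_comm]
      obtain ⟨b, hle⟩ := M.exists_action_le (l (0, 1))
        (fun j => l (Pi.single j 1, 0)) a.2.1 a.2.2
      exact ⟨b, (hl _ _).trans_le (hle.trans (hl _ _).ge)⟩)
  have hq1 : ∑ b, ENNReal.ofReal (w b) = 1 := by
    rw [← ENNReal.ofReal_sum_of_nonneg fun b _ => hw0 b, hw1, ENNReal.ofReal_one]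
  refine ⟨PMF.ofFintype (fun b => ENNReal.ofReal (w b)) hq1, PMF.ext fun y => ?_, ?_⟩
  · have hy := congrFun (congrArg Prod.fst hw) y
    rw [Prod.fst_sum, Finset.sum_apply] at hy
    simp only [Prod.smul_fst, Pi.smul_apply, smul_eq_mul] at hy
    rw [PMF.bind_apply, tsum_fintype]
    simp only [PMF.ofFintype_apply]
    change ∑ b, ENNReal.ofReal (w b) * ENNReal.ofReal
      (M.α * nuOf b.1.1 b.1.2 y + (1 - M.α) * zOf b.1.1 y) =
        ENNReal.ofReal (M.α * a.1.1.2 y + (1 - M.α) * a.1.2 y)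
    rw [← hy, ENNReal.ofReal_sum_of_nonneg fun b _ => mul_nonneg (hw0 b)
      (M.mix_nonneg (nuOf_nonneg _ _) (zOf_nonneg _) y)]
    exact Finset.sum_congr rfl fun b _ => (ENNReal.ofReal_mul (hw0 b)).symm
  · have hc := congrArg Prod.snd hw
    rw [Prod.snd_sum] at hc
    simp only [Prod.smul_snd, smul_eq_mul] at hc
    rw [tsum_fintype]
    simp only [PMF.ofFintype_apply, ENNReal.toReal_ofReal (hw0 _)]
    exact hc

theorem oneStep_randomizedStationary {a : ∀ i, M.relaxed.Action i} (ha : M.Minimizing v lam a)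
    {f : ∀ i, PMF (M.maxRank.Action i)} (hf : M.Implements f a) (p : M.maxRank.Past)
    (x : Fin n) :
    M.maxRank.oneStep v x (M.maxRank.randomizedStationary f p x) = v x + lam := by
  obtain ⟨C, hC⟩ := M.exists_bound_maxRank_cost
  obtain ⟨V, hV⟩ := exists_bound v
  rw [MarkovDecision.randomizedStationary, MarkovDecision.oneStep,
    PMF.expect_add _ (fun b _ => hC x b) fun b _ => PMF.abs_expect_le _ fun j _ => hV j,
    ← PMF.expect_bind _ _ fun j _ => hV j, (hf x).1, PMF.expect, (hf x).2, relaxed_eq_bellman,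
    ha x]

end WebModel

theorem proposition3 {n : ℕ} (M : WebModel n) :
    -- the equation has a solution, and the constant is unique
    (∃! lam : ℝ, ∃ v : Fin n → ℝ, M.IsSolution v lam) ∧
    ∀ (v : Fin n → ℝ) (lam : ℝ), M.IsSolution v lam →
      -- the constant is the value of the MaxRank problem
      M.maxRank.IsValue lam ∧
      -- it is also the value when all of `P_i × Z` is allowed
      M.relaxed.IsValue lam ∧
      -- any selection of minimizers is an optimal stationary strategy, and the corresponding
      -- stationary strategies of the MaxRank problem exist and are optimal
      (∀ a : ∀ i, M.relaxed.Action i, M.Minimizing v lam a →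
        M.relaxed.IsOptimal (M.relaxed.stationary a) ∧
        (∃ f : ∀ i, PMF (M.maxRank.Action i), M.Implements f a) ∧
        ∀ f : ∀ i, PMF (M.maxRank.Action i), M.Implements f a →
          M.maxRank.IsOptimal (M.maxRank.randomizedStationary f)) ∧
      -- the minima are attained by link and teleportation sets `(I_i, J_i)`, and any such choice
      -- is an optimal deterministic stationary strategy of the MaxRank problem
      (∃ b : ∀ i, M.maxRank.Action i, M.MinimizingLinks v lam b) ∧
      (∀ b : ∀ i, M.maxRank.Action i, M.MinimizingLinks v lam b →
        M.maxRank.IsOptimal (M.maxRank.stationary b)) := by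
  refine ⟨?_, fun v lam h => ⟨h.isValue_maxRank, h.isValue_relaxed, fun a ha => ⟨?_, ?_, ?_⟩,
    h.exists_minimizingLinks, ?_⟩⟩
  · obtain ⟨v, lam, h⟩ := M.exists_isSolution
    refine ⟨lam, ⟨v, h⟩, fun lam' ⟨v', h'⟩ => ?_⟩
    -- Both constants are the value of the same problem, from any initial law.
    let μ : PMF (Fin n) := PMF.pure ⟨0, M.N_pos.trans M.N_le⟩
    exact (h'.isValue_maxRank μ).unique (h.isValue_maxRank μ)
  · obtain ⟨C, hC⟩ := M.exists_bound_relaxed_cost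
    obtain ⟨V, hV⟩ := WebModel.exists_bound v
    exact MarkovDecision.isOptimal_of_oneStep_eq hC hV h.le_relaxed
      (WebModel.oneStep_relaxed_stationary ha)
  · choose f hf using fun i => WebModel.exists_law_implementing i (a i)
    exact ⟨f, hf⟩
  · intro f hf
    obtain ⟨C, hC⟩ := M.exists_bound_maxRank_cost
    obtain ⟨V, hV⟩ := WebModel.exists_bound v
    exact MarkovDecision.isOptimal_of_oneStep_eq hC hV h.le_maxRank
      (WebModel.oneStep_randomizedStationary ha hf)
  · intro b hb
    obtain ⟨C, hC⟩ := M.exists_bound_maxRank_cost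
    obtain ⟨V, hV⟩ := WebModel.exists_bound v
    exact MarkovDecision.isOptimal_of_oneStep_eq hC hV h.le_maxRank
      (WebModel.oneStep_maxRank_stationary hb)
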